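/- Consider a library of $n$ items and $k\ge 1$ caches, each holding an ordered vector of $m$ distinct items, where $1\le m<n$ (caches $1,\dots,k-1$ are virtual, cache $k$ is the real one). Successive requests are independent, item $i$ being requested with Zipf$(\alpha)$ probability $p_i=A/i^{\alpha}$, $1\le i\le n$, where $0<\alpha<1$ and $A$ is such that $\sum_{i=1}^n p_i=1$. Under the policy $k$-LRU, when item $i$ is requested each cache $l$ is updated according to the state just before the request: if $i$ is in position $j$ of cache $l$, then $i$ moves to the first position of cache $l$ and the items in positions $1,\dots,j-1$ move back one position; if $i$ is not in cache $l$, but $l=1$ or $i$ is in cache $l-1$, then $i$ is inserted in the first position of cache $l$, all other items of cache $l$ move back one position and the last one is evicted; otherwise cache $l$ does not change. Let $P$ be the transition matrix of the resulting Markov chain on the set $\mathcal S$ of all $k$-tuples of vectors of $m$ distinct items. Then $P$ has a unique stationary distribution $\pi^*$, and the mixing time $$t_{\mathrm{mix}}^{k\text{-LRU}}=\min\Big\{t\in\mathbb N:\ \max_{x\in\mathcal S}\ \tfrac12\sum_{y\in\mathcal S}\big|P^t(x,y)-\pi^*(y)\big|\le\tfrac12\Big\}$$ exists (is finite) and satisfies,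 for fixed $k$, $m$ and $\alpha$, $$t_{\mathrm{mix}}^{k\text{-LRU}}=O\!\left(n^{(k+1)k(2m-1)m+4(k\alpha-1)m+6}\,\ln n\right),$$ that is, there is a constant $C$ depending only on $k,m,\alpha$ such that $t_{\mathrm{mix}}^{k\text{-LRU}}\le C\,n^{(k+1)k(2m-1)m+4(k\alpha-1)m+6}\ln n$ for all $n>m$. -/

import Mathlib

noncomputable section

namespace KLRU

/-- The Zipf popularity law on a library of `n` items: the item `i : Fin n`, of popularity rank
`i + 1`, is requested with probability `A / (i + 1) ^ α`, where `A` normalises the total to `1`. -/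
def zipf (n : ℕ) (α : ℝ) (i : Fin n) : ℝ :=
  (∑ j : Fin n, 1 / ((j : ℝ) + 1) ^ α)⁻¹ / ((i : ℝ) + 1) ^ α

/-- The content of one cache of size `m`: a vector of `m` distinct items of the library, the most
recently used one first. -/
abbrev Level (n m : ℕ) : Type :=
  {v : List.Vector (Fin n) m // v.toList.Nodup}

/-- A state of the whole system: one vector for each of the `k` caches. The caches with index
`0, …, k - 2` are the virtual (meta) caches, the one with index `k - 1` is the real cache. -/
abbrev State (k n m : ℕ) : Type := Fin k → Level n m

/-- Put item `i` in first position. If `i` was in position `j`, the items in positions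
`1, …, j - 1` move back one position (`take m` then changes nothing); if `i` was absent, all items
move back one position and the last one is evicted (`erase` then changes nothing). -/
def toFront {n m : ℕ} (i : Fin n) (v : Level n m) : Level n m :=
  ⟨⟨(i :: v.1.toList.erase i).take m, by
      have h := v.1.toList_length
      have h' := List.le_length_erase (l := v.1.toList) (a := i)
      simp only [List.length_take, List.length_cons]
      omega⟩, by
      have h : (i :: v.1.toList.erase i).Nodup :=
        List.nodup_cons.2 ⟨v.2.not_mem_erase, v.2.erase i⟩
      exact h.sublist (List.take_sublist _ _)⟩

/-- One request under `k`-LRU. Cache `l` puts the requested item `i` in its first position if `i`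
is in cache `l` already, or if `i` is in the preceding cache (the first cache accepts every item);
otherwise it is unchanged. Membership refers to the state `x` just before the request. -/
def step {k n m : ℕ} (x : State k n m) (i : Fin n) : State k n m := fun l =>
  if i ∈ (x l).1.toList ∨ (l : ℕ) = 0 ∨ ∃ l' : Fin k, (l' : ℕ) + 1 = l ∧ i ∈ (x l').1.toList then
    toFront i (x l)
  else x l

/-- The transition matrix of `k`-LRU when the successive requests are independent, each being a
request of item `i` with probability `p i` (the independent reference model). -/
def transition (k m : ℕ) {n : ℕ} (p : Fin n → ℝ) : Matrix (State k n m) (State k n m) ℝ :=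
  fun x y => ∑ i : Fin n, if step x i = y then p i else 0

/-- `π` is a stationary probability distribution of the chain with transition matrix `P`. -/
structure IsStationary {S : Type*} [Fintype S] (P : Matrix S S ℝ) (π : S → ℝ) : Prop where
  nonneg : ∀ x, 0 ≤ π x
  sum_eq_one : ∑ x, π x = 1
  invariant : ∀ y, ∑ x, π x * P x y = π y

/-- Total variation distance of two distributions on a finite set. -/
def tvDist {S : Type*} [Fintype S] (μ ν : S → ℝ) : ℝ := (1 / 2) * ∑ x, |μ x - ν x|

/-- `t` is the `ε`-mixing time of the chain with transition matrix `P` and stationary distribution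
`π`: the smallest number of steps after which, from every initial state, the law of the chain is
within `ε` of `π` in total variation. -/
def IsMixingTime {S : Type*} [Fintype S] [DecidableEq S] (P : Matrix S S ℝ) (π : S → ℝ) (ε : ℝ)
    (t : ℕ) : Prop :=
  IsLeast {s : ℕ | ∀ x : S, tvDist ((P ^ s) x) π ≤ ε} t

end KLRU

end

/-! A Doeblin minorisation. Request each of the `m` most popular items `k` times in a row: each
block of `k` requests carries its item through the chain of caches to the front of all of them, and
`m` distinct items fill every cache, so the final state does not depend on the initial one
(`foldl_step_flatMap_replicate`, `foldl_toFront_eq`). Each of these requests has probability at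
least `1 / (n * m)`, so a fixed state is reached in `k * m` steps with probability at least `(n * m)
^ (-k * m)`. Hence the mixing time is `O(n ^ (k * m))`, and `k * m` is at most the stated exponent.
-/

namespace KLRU

/-! ### Doeblin's theorem for finite stochastic matrices. -/

section Doeblin

open Matrix

variable {S : Type*} [Fintype S]

/-- A matrix with nonnegative entries all of whose rows sum to `1`. -/
structure IsStochastic (P : Matrix S S ℝ) : Prop where
  nonneg : ∀ x y, 0 ≤ P x y
  sum_row : ∀ x, ∑ y, P x y = 1

theorem IsStochastic.mul {P Q : Matrix S S ℝ} (hP : IsStochastic P) (hQ : IsStochastic Q) :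
    IsStochastic (P * Q) where
  nonneg x y := Finset.sum_nonneg fun z _ => mul_nonneg (hP.nonneg x z) (hQ.nonneg z y)
  sum_row x := by
    simp only [Matrix.mul_apply]
    rw [Finset.sum_comm]
    simp only [← Finset.mul_sum, hQ.sum_row, mul_one, hP.sum_row]

theorem sum_vecMul {P : Matrix S S ℝ} (hP : IsStochastic P) (w : S → ℝ) :
    ∑ y, (w ᵥ* P) y = ∑ x, w x := by
  simp only [Matrix.vecMul, dotProduct]
  rw [Finset.sum_comm]
  simp only [← Finset.mul_sum, hP.sum_row, mul_one]

variable [DecidableEq S]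

theorem IsStochastic.pow {P : Matrix S S ℝ} (hP : IsStochastic P) (s : ℕ) :
    IsStochastic (P ^ s) := by
  induction s with
  | zero =>
    refine ⟨fun x y => ?_, fun x => ?_⟩
    · rw [pow_zero, Matrix.one_apply]
      split_ifs <;> norm_num
    · simp [Matrix.one_apply]
  | succ s ih => rw [pow_succ]; exact ih.mul hP

/-- If every row of a stochastic matrix gives mass at least `δ` to the state `z`, the matrix
contracts the `ℓ¹` norm of vectors of total mass `0` by the factor `1 - δ`. -/
theorem sum_abs_vecMul_le {Q : Matrix S S ℝ} (hQ : IsStochastic Q) {δ : ℝ} {z : S}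
    (hz : ∀ x, δ ≤ Q x z) {w : S → ℝ} (hw : ∑ x, w x = 0) :
    ∑ y, |(w ᵥ* Q) y| ≤ (1 - δ) * ∑ x, |w x| := by
  have hR : ∀ x y, 0 ≤ Q x y - if y = z then δ else 0 := by
    intro x y
    split_ifs with h
    · subst h; linarith [hz x]
    · simpa using hQ.nonneg x y
  -- Subtracting `δ` from column `z` is invisible to a `w` of mass `0`, and leaves a nonnegative
  -- matrix with row sums `1 - δ`.
  have key : ∀ y, (w ᵥ* Q) y = ∑ x, w x * (Q x y - if y = z then δ else 0) := by
    intro y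
    simp only [mul_sub, Finset.sum_sub_distrib, ← Finset.sum_mul, hw, zero_mul, sub_zero]
    rfl
  calc ∑ y, |(w ᵥ* Q) y| ≤ ∑ y, ∑ x, |w x| * (Q x y - if y = z then δ else 0) := by
        refine Finset.sum_le_sum fun y _ => ?_
        rw [key]
        refine (Finset.abs_sum_le_sum_abs _ _).trans_eq (Finset.sum_congr rfl fun x _ => ?_)
        rw [abs_mul, abs_of_nonneg (hR x y)]
    _ = (1 - δ) * ∑ x, |w x| := by
        rw [Finset.sum_comm, Finset.mul_sum]
        refine Finset.sum_congr rfl fun x _ => ?_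
        rw [← Finset.mul_sum, Finset.sum_sub_distrib, hQ.sum_row]
        simp [mul_comm]

theorem sum_abs_vecMul_pow_le {Q : Matrix S S ℝ} (hQ : IsStochastic Q) {δ : ℝ} (hδ : δ ≤ 1) {z : S}
    (hz : ∀ x, δ ≤ Q x z) {w : S → ℝ} (hw : ∑ x, w x = 0) (s : ℕ) :
    ∑ y, |(w ᵥ* Q ^ s) y| ≤ (1 - δ) ^ s * ∑ x, |w x| := by
  induction s with
  | zero => simp
  | succ s ih =>
    rw [pow_succ, ← Matrix.vecMul_vecMul, pow_succ', mul_assoc]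
    refine (sum_abs_vecMul_le hQ hz ((sum_vecMul (hQ.pow s) w).trans hw)).trans ?_
    exact mul_le_mul_of_nonneg_left ih (by linarith)

theorem vecMul_pow_of_vecMul_eq {P : Matrix S S ℝ} {v : S → ℝ} (h : v ᵥ* P = v) (s : ℕ) :
    v ᵥ* P ^ s = v := by
  induction s with
  | zero => simp
  | succ s ih => rw [pow_succ, ← Matrix.vecMul_vecMul, ih, h]

theorem eq_zero_of_vecMul_eq {P : Matrix S S ℝ} (hP : IsStochastic P) {N : ℕ} {δ : ℝ}
    (hδ : 0 < δ) {z : S} (hz : ∀ x, δ ≤ (P ^ N) x z) {w : S → ℝ} (hw : ∑ x, w x = 0)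
    (h : w ᵥ* P = w) : w = 0 := by
  have h1 := sum_abs_vecMul_le (hP.pow N) hz hw
  rw [vecMul_pow_of_vecMul_eq h] at h1
  have h0 : 0 ≤ ∑ x, |w x| := Finset.sum_nonneg fun x _ => abs_nonneg _
  have h2 : ∑ x, |w x| = 0 := by nlinarith
  funext x
  have := (Finset.sum_eq_zero_iff_of_nonneg fun x _ => abs_nonneg (w x)).1 h2 x (Finset.mem_univ x)
  exact abs_eq_zero.1 this

/-- The constant vector is a right eigenvector for `1`, so `P - 1` is singular and has a left null
vector too. -/
theorem exists_vecMul_eq {P : Matrix S S ℝ} (hP : IsStochastic P) [Nonempty S] :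
    ∃ v : S → ℝ, v ≠ 0 ∧ v ᵥ* P = v := by
  have hdet : (P - 1).det = 0 := by
    refine Matrix.exists_mulVec_eq_zero_iff.1 ⟨fun _ => 1, ?_, ?_⟩
    · obtain ⟨x⟩ := ‹Nonempty S›
      exact fun h => one_ne_zero (congrFun h x)
    · rw [Matrix.sub_mulVec, Matrix.one_mulVec]
      funext x
      simp [Matrix.mulVec, dotProduct, hP.sum_row]
  obtain ⟨v, hv, h⟩ := Matrix.exists_vecMul_eq_zero_iff.2 hdet
  refine ⟨v, hv, ?_⟩
  rwa [Matrix.vecMul_sub, Matrix.vecMul_one, sub_eq_zero] at h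

theorem exists_sum_eq_one_vecMul_eq {P : Matrix S S ℝ} (hP : IsStochastic P) {N : ℕ} {δ : ℝ}
    (hδ : 0 < δ) {z : S} (hz : ∀ x, δ ≤ (P ^ N) x z) :
    ∃ v : S → ℝ, ∑ x, v x = 1 ∧ v ᵥ* P = v := by
  have : Nonempty S := ⟨z⟩
  obtain ⟨v, hv, h⟩ := exists_vecMul_eq hP
  have hs : ∑ x, v x ≠ 0 := fun hs => hv (eq_zero_of_vecMul_eq hP hδ hz hs h)
  refine ⟨(∑ x, v x)⁻¹ • v, ?_, ?_⟩
  · simp only [Pi.smul_apply, smul_eq_mul, ← Finset.mul_sum]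
    exact inv_mul_cancel₀ hs
  · rw [Matrix.smul_vecMul, h]

/-- The sign of `v` is still unknown, hence `∑ |v y|` instead of `1`; this bound is what yields
nonnegativity next. -/
theorem sum_abs_row_sub_le {P : Matrix S S ℝ} (hP : IsStochastic P) {N : ℕ} {δ : ℝ} (hδ : δ ≤ 1)
    {z : S} (hz : ∀ x, δ ≤ (P ^ N) x z) {v : S → ℝ} (hv : ∑ x, v x = 1) (h : v ᵥ* P = v)
    (s : ℕ) (x : S) :
    ∑ y, |(P ^ (N * s)) x y - v y| ≤ (1 - δ) ^ s * (1 + ∑ y, |v y|) := by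
  have hw : ∑ y, ((Pi.single x 1 : S → ℝ) - v) y = 0 := by
    simp [Finset.sum_sub_distrib, hv]
  have h1 := sum_abs_vecMul_pow_le (hP.pow N) hδ hz hw s
  rw [← pow_mul, Matrix.sub_vecMul, vecMul_pow_of_vecMul_eq h, Matrix.single_one_vecMul] at h1
  refine h1.trans (mul_le_mul_of_nonneg_left ?_ (pow_nonneg (by linarith) s))
  calc ∑ y, |((Pi.single x 1 : S → ℝ) - v) y| ≤ ∑ y, (|(Pi.single x 1 : S → ℝ) y| + |v y|) :=
        Finset.sum_le_sum fun y _ => abs_sub _ _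
    _ = 1 + ∑ y, |v y| := by
        rw [Finset.sum_add_distrib]
        congr 1
        simp [Pi.single_apply, apply_ite abs]

/-- `v` is a limit of rows of powers of `P`, which are nonnegative. -/
theorem nonneg_of_vecMul_eq {P : Matrix S S ℝ} (hP : IsStochastic P) {N : ℕ} {δ : ℝ} (hδ₀ : 0 < δ)
    (hδ : δ ≤ 1) {z : S} (hz : ∀ x, δ ≤ (P ^ N) x z) {v : S → ℝ} (hv : ∑ x, v x = 1)
    (h : v ᵥ* P = v) (y : S) : 0 ≤ v y := by
  have hlim : Filter.Tendsto (fun s : ℕ => -((1 - δ) ^ s * (1 + ∑ y, |v y|))) Filter.atTop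
      (nhds (-(0 * (1 + ∑ y, |v y|)))) :=
    ((tendsto_pow_atTop_nhds_zero_of_lt_one (by linarith) (by linarith)).mul_const _).neg
  rw [zero_mul, neg_zero] at hlim
  refine le_of_tendsto hlim (Filter.Eventually.of_forall fun s => ?_)
  have h1 := sum_abs_row_sub_le hP hδ hz hv h s z
  have h2 := Finset.single_le_sum (f := fun y => |(P ^ (N * s)) z y - v y|)
    (fun y _ => abs_nonneg _) (Finset.mem_univ y)
  have h3 := (hP.pow (N * s)).nonneg z y
  have h4 := le_abs_self ((P ^ (N * s)) z y - v y)
  linarith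

/-- Doeblin's theorem: if from every state the chain is at `z` after `N` steps with probability at
least `δ`, it has a unique stationary distribution, and its `1 / 2`-mixing time is at most
`2 * N / δ`. -/
theorem exists_isStationary_isMixingTime {P : Matrix S S ℝ} (hP : IsStochastic P) {N : ℕ} {δ : ℝ}
    (hδ₀ : 0 < δ) {z : S} (hz : ∀ x, δ ≤ (P ^ N) x z) :
    ∃ π : S → ℝ, IsStationary P π ∧ (∀ π', IsStationary P π' → π' = π) ∧
      ∃ t : ℕ, IsMixingTime P π (1 / 2) t ∧ (t : ℝ) ≤ 2 * N / δ := by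
  have hδ : δ ≤ 1 := by
    rw [← (hP.pow N).sum_row z]
    exact (hz z).trans (Finset.single_le_sum (f := fun y => (P ^ N) z y)
      (fun y _ => (hP.pow N).nonneg z y) (Finset.mem_univ z))
  obtain ⟨v, hv, h⟩ := exists_sum_eq_one_vecMul_eq hP hδ₀ hz
  have hpos := nonneg_of_vecMul_eq hP hδ₀ hδ hz hv h
  refine ⟨v, ⟨hpos, hv, fun y => congrFun h y⟩, fun π' hπ' => ?_, ?_⟩
  · refine sub_eq_zero.1 (eq_zero_of_vecMul_eq hP hδ₀ hz ?_ ?_)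
    · simp [Finset.sum_sub_distrib, hv, hπ'.sum_eq_one]
    · rw [Matrix.sub_vecMul, h]
      congr 1
      funext y
      exact hπ'.invariant y
  -- This makes `(1 - δ) ^ s ≤ exp (-1) ≤ 1 / 2`; rounding up at most doubles `1 / δ ≥ 1`.
  set s := ⌈1 / δ⌉₊ with hs
  have hs1 : 1 / δ ≤ s := Nat.le_ceil _
  have hs2 : (s : ℝ) ≤ 2 / δ := by
    have h1 : (s : ℝ) < 1 / δ + 1 := Nat.ceil_lt_add_one (by positivity)
    have h2 : 1 ≤ 1 / δ := (one_le_div hδ₀).2 hδ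
    have h3 : 2 / δ = 1 / δ + 1 / δ := by ring
    linarith
  have hmem : N * s ∈ {r : ℕ | ∀ x : S, tvDist ((P ^ r) x) v ≤ 1 / 2} := by
    intro x
    have h1 := sum_abs_row_sub_le hP hδ hz hv h s x
    simp only [abs_of_nonneg (hpos _), hv] at h1
    have h2 : (1 - δ) ^ s ≤ 1 / 2 := by
      calc (1 - δ) ^ s ≤ Real.exp (-δ) ^ s :=
            pow_le_pow_left₀ (by linarith) (Real.one_sub_le_exp_neg δ) s
        _ = Real.exp (-(s * δ)) := by rw [← Real.exp_nat_mul]; ring_nf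
        _ ≤ Real.exp (-1) := by
            refine Real.exp_le_exp.2 (neg_le_neg ?_)
            rwa [div_le_iff₀ hδ₀] at hs1
        _ ≤ 1 / 2 := by
            rw [Real.exp_neg, one_div]
            exact inv_anti₀ two_pos (by linarith [Real.add_one_le_exp (1 : ℝ)])
    unfold tvDist
    linarith
  refine ⟨sInf {r : ℕ | ∀ x : S, tvDist ((P ^ r) x) v ≤ 1 / 2},
    ⟨Nat.sInf_mem ⟨_, hmem⟩, fun r hr => Nat.sInf_le hr⟩, ?_⟩
  calc ((sInf {r : ℕ | ∀ x : S, tvDist ((P ^ r) x) v ≤ 1 / 2} : ℕ) : ℝ) ≤ ((N * s : ℕ) : ℝ) :=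
        Nat.cast_le.2 (Nat.sInf_le hmem)
    _ = N * s := by push_cast; ring
    _ ≤ N * (2 / δ) := mul_le_mul_of_nonneg_left hs2 (Nat.cast_nonneg N)
    _ = 2 * N / δ := by ring

end Doeblin

/-! ### Request sequences that erase the initial state. -/

section Requests

variable {k n m : ℕ}

theorem isStochastic_transition {p : Fin n → ℝ} (hp : ∀ i, 0 ≤ p i) (hs : ∑ i, p i = 1) :
    IsStochastic (transition k m p) where
  nonneg x y := Finset.sum_nonneg fun i _ => by split_ifs; exacts [hp i, le_rfl]
  sum_row x := by
    simp only [transition]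
    rw [Finset.sum_comm]
    simpa using hs

/-- The law of the state after a given sequence of requests gives that sequence its weight. -/
theorem pow_length_le_transition_pow {p : Fin n → ℝ} (hp : ∀ i, 0 ≤ p i) (hs : ∑ i, p i = 1)
    {c : ℝ} (hc : 0 ≤ c) (w : List (Fin n)) (hw : ∀ i ∈ w, c ≤ p i) (x : State k n m) :
    c ^ w.length ≤ (transition k m p ^ w.length) x (w.foldl step x) := by
  induction w generalizing x with
  | nil => simp
  | cons i w ih =>
    have hP := isStochastic_transition (k := k) (m := m) hp hs
    have h1 : c ≤ transition k m p x (step x i) := by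
      refine (hw i List.mem_cons_self).trans ?_
      have := Finset.single_le_sum (f := fun j => if step x j = step x i then p j else 0)
        (fun j _ => by split_ifs; exacts [hp j, le_rfl]) (Finset.mem_univ i)
      simpa [transition] using this
    have h2 := ih (fun j hj => hw j (List.mem_cons_of_mem i hj)) (step x i)
    rw [List.length_cons, pow_succ', pow_succ', Matrix.mul_apply, List.foldl_cons]
    refine (mul_le_mul h1 h2 (pow_nonneg hc _) (hP.nonneg _ _)).trans ?_
    exact Finset.single_le_sum
      (f := fun y => transition k m p x y * (transition k m p ^ w.length) y (w.foldl step (step x i)))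
      (fun y _ => mul_nonneg (hP.nonneg _ _) ((hP.pow _).nonneg _ _)) (Finset.mem_univ (step x i))

theorem toList_toFront (i : Fin n) (v : Level n m) :
    (toFront i v).1.toList = (i :: v.1.toList.erase i).take m := rfl

theorem level_ext {v w : Level n m} (h : v.1.toList = w.1.toList) : v = w :=
  Subtype.ext (List.Vector.toList_injective h)

theorem mem_toFront (hm : 1 ≤ m) (i : Fin n) (v : Level n m) : i ∈ (toFront i v).1.toList := by
  obtain ⟨m, rfl⟩ := Nat.exists_eq_add_of_le' hm
  rw [toList_toFront, List.take_succ_cons]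
  exact List.mem_cons_self

theorem toFront_toFront (hm : 1 ≤ m) (i : Fin n) (v : Level n m) :
    toFront i (toFront i v) = toFront i v := by
  obtain ⟨m, rfl⟩ := Nat.exists_eq_add_of_le' hm
  apply level_ext
  rw [toList_toFront, toList_toFront]
  simp [List.take_take]

/-- After `k` consecutive requests of the same item, it has been put in front in all `k` caches. -/
theorem foldl_step_replicate (hm : 1 ≤ m) (i : Fin n) (x : State k n m) :
    (List.replicate k i).foldl step x = fun l => toFront i (x l) := by
  -- The first clause keeps each cache from changing in any other way before `i` reaches it; cache
  -- `l` (counted from `0`) is reached by request `l + 1` at the latest.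
  have key : ∀ j : ℕ, ∀ l : Fin k,
      ((List.replicate j i).foldl step x l = toFront i (x l) ∨
        (List.replicate j i).foldl step x l = x l) ∧
      ((l : ℕ) < j → (List.replicate j i).foldl step x l = toFront i (x l)) := by
    intro j
    induction j with
    | zero => intro l; simp
    | succ j ih =>
      intro l
      rw [List.replicate_succ', List.foldl_append]
      generalize (List.replicate j i).foldl step x = y at ih
      simp only [List.foldl_cons, List.foldl_nil, step]
      obtain ⟨h1, h2⟩ := ih l
      rcases h1 with h1 | h1
      · have : i ∈ (y l).1.toList := h1 ▸ mem_toFront hm i _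
        rw [if_pos (Or.inl this), h1, toFront_toFront hm]
        simp
      · rw [h1]
        refine ⟨?_, fun hl => ?_⟩
        · split_ifs <;> simp
        · rw [if_pos]
          rcases Nat.eq_zero_or_pos (l : ℕ) with h0 | h0
          · exact Or.inr (Or.inl h0)
          · refine Or.inr (Or.inr ⟨⟨l - 1, by omega⟩, by simp; omega, ?_⟩)
            rw [(ih ⟨l - 1, by omega⟩).2 (by simp; omega)]
            exact mem_toFront hm i _
  funext l
  exact (key k l).2 l.2

theorem foldl_step_flatMap_replicate (hm : 1 ≤ m) (L : List (Fin n)) (x : State k n m) :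
    (L.flatMap (List.replicate k)).foldl step x =
      fun l => L.foldl (fun v i => toFront i v) (x l) := by
  induction L generalizing x with
  | nil => rfl
  | cons i L ih =>
    rw [List.flatMap_cons, List.foldl_append, foldl_step_replicate hm, ih]
    rfl

theorem reverse_prefix_foldl_toFront (L : List (Fin n)) (hL : L.Nodup) (hlen : L.length ≤ m)
    (v : Level n m) : L.reverse <+: (L.foldl (fun v i => toFront i v) v).1.toList := by
  induction L using List.reverseRecOn with
  | nil => simp
  | append_singleton L i ih =>
    rw [List.length_append, List.length_singleton] at hlen
    have hL' := List.nodup_append.1 hL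
    -- So erasing `i` acts only behind the prefix already built.
    have hi : i ∉ L.reverse := fun h =>
      hL'.2.2 i (List.mem_reverse.1 h) i (List.mem_singleton.2 rfl) rfl
    obtain ⟨r, hr⟩ := ih hL'.1 (by omega)
    rw [List.foldl_append, List.foldl_cons, List.foldl_nil, toList_toFront, ← hr,
      List.erase_append_right _ hi, List.reverse_append, List.reverse_singleton,
      List.singleton_append, ← List.cons_append, List.prefix_take_iff]
    exact ⟨List.prefix_append _ _, by simpa using hlen⟩

/-- Putting `m` distinct items in front one after the other erases the past. -/
theorem foldl_toFront_eq (L : List (Fin n)) (hL : L.Nodup) (hlen : L.length = m)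
    (v w : Level n m) :
    L.foldl (fun v i => toFront i v) v = L.foldl (fun v i => toFront i v) w := by
  have key : ∀ v : Level n m, L.reverse = (L.foldl (fun v i => toFront i v) v).1.toList := fun v =>
    (reverse_prefix_foldl_toFront L hL hlen.le v).eq_of_length (by simp [hlen])
  exact level_ext ((key v).symm.trans (key w))

theorem zipf_nonneg (n : ℕ) (α : ℝ) (i : Fin n) : 0 ≤ zipf n α i := by
  unfold zipf
  positivity

theorem sum_zipf {n : ℕ} (hn : 0 < n) (α : ℝ) : ∑ i, zipf n α i = 1 := by
  have : 0 < ∑ j : Fin n, 1 / ((j : ℝ) + 1) ^ α :=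
    Finset.sum_pos (fun j _ => by positivity) ⟨⟨0, hn⟩, Finset.mem_univ _⟩
  simp only [zipf, div_eq_mul_inv, one_mul, ← Finset.mul_sum] at this ⊢
  exact inv_mul_cancel₀ this.ne'

/-- The normalising sum has `n` terms at most `1`, and `(i + 1) ^ α ≤ i + 1 ≤ m`. -/
theorem le_zipf {n m : ℕ} {α : ℝ} (hα₀ : 0 ≤ α) (hα₁ : α ≤ 1) (i : Fin n) (hi : (i : ℕ) < m) :
    1 / ((n : ℝ) * m) ≤ zipf n α i := by
  have hpos : 0 < ∑ j : Fin n, 1 / ((j : ℝ) + 1) ^ α :=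
    Finset.sum_pos (fun j _ => by positivity) ⟨i, Finset.mem_univ _⟩
  have hsum : ∑ j : Fin n, 1 / ((j : ℝ) + 1) ^ α ≤ n := by
    calc ∑ j : Fin n, 1 / ((j : ℝ) + 1) ^ α ≤ ∑ _j : Fin n, (1 : ℝ) := by
          refine Finset.sum_le_sum fun j _ => ?_
          have : (1 : ℝ) ≤ ((j : ℝ) + 1) ^ α := Real.one_le_rpow (by simp) hα₀
          exact (div_le_one (by positivity)).2 this
      _ = n := by simp
  have hpow : ((i : ℝ) + 1) ^ α ≤ m := by
    calc ((i : ℝ) + 1) ^ α ≤ ((i : ℝ) + 1) ^ (1 : ℝ) :=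
          Real.rpow_le_rpow_of_exponent_le (by simp) hα₁
      _ = (i : ℝ) + 1 := Real.rpow_one _
      _ ≤ m := by exact_mod_cast hi
  rw [zipf, inv_eq_one_div, div_div]
  exact one_div_le_one_div_of_le (by positivity) (by gcongr)

/-- From every state, `k * m` requests lead to one and the same state with probability at least
`(n * m) ^ (-k * m)`. -/
theorem exists_le_transition_pow (hm : 1 ≤ m) (hn : m < n) {α : ℝ} (hα₀ : 0 ≤ α) (hα₁ : α ≤ 1) :
    ∃ z : State k n m, ∀ x, (1 / ((n : ℝ) * m)) ^ (k * m) ≤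
      (transition k m (zipf n α) ^ (k * m)) x z := by
  set L : List (Fin n) := (List.finRange m).map (Fin.castLE hn.le) with hL
  have hnd : L.Nodup := (List.nodup_finRange m).map (Fin.castLE_injective hn.le)
  have hlen : L.length = m := by simp [hL]
  -- An arbitrary starting content, needed only to name the common final state.
  set v₀ : Level n m := ⟨⟨L, hlen⟩, hnd⟩
  refine ⟨fun _ => L.foldl (fun v i => toFront i v) v₀, fun x => ?_⟩
  have hw : ∀ i ∈ L.flatMap (List.replicate k), 1 / ((n : ℝ) * m) ≤ zipf n α i := by
    intro i hi
    obtain ⟨j, hj, hij⟩ := List.mem_flatMap.1 hi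
    rw [List.eq_of_mem_replicate hij]
    obtain ⟨a, -, rfl⟩ := List.mem_map.1 hj
    exact le_zipf hα₀ hα₁ _ a.2
  have hlen' : (L.flatMap (List.replicate k)).length = k * m := by
    simp [List.length_flatMap, hlen, mul_comm]
  have h := pow_length_le_transition_pow (zipf_nonneg n α) (sum_zipf (by omega) α)
    (by positivity) _ hw x
  rw [hlen', foldl_step_flatMap_replicate hm] at h
  convert h using 2
  funext l
  exact foldl_toFront_eq L hnd hlen _ _

end Requests

/-- Dropping the `α` term and reducing to `k = 1`, the difference is at least `4 * m ^ 2 - 7 * m + 6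
> 0`. -/
theorem mul_le_mixing_exponent {k m α : ℝ} (hk : 1 ≤ k) (hm : 1 ≤ m) (hα : 0 ≤ α) :
    k * m ≤ (k + 1) * k * (2 * m - 1) * m + 4 * (k * α - 1) * m + 6 := by
  have h1 : 0 ≤ k * α * m := by positivity
  have h2 : (k + 1) * (2 * m - 1) * m - m ≤ k * ((k + 1) * (2 * m - 1) * m - m) := by
    refine le_mul_of_one_le_left ?_ hk
    nlinarith [mul_nonneg (sub_nonneg.2 hk) (sub_nonneg.2 hm)]
  have h3 : 2 * ((2 * m - 1) * m) ≤ (k + 1) * ((2 * m - 1) * m) :=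
    mul_le_mul_of_nonneg_right (by linarith) (mul_nonneg (by linarith) (by linarith))
  nlinarith [sq_nonneg (m - 1)]

end KLRU

theorem mainTheorem10 (k m : ℕ) (hk : 1 ≤ k) (hm : 1 ≤ m) (α : ℝ) (hα₀ : 0 < α) (hα₁ : α < 1) :
    ∃ C : ℝ, ∀ n : ℕ, m < n →
      ∃ π : KLRU.State k n m → ℝ,
        KLRU.IsStationary (KLRU.transition k m (KLRU.zipf n α)) π ∧
        (∀ π' : KLRU.State k n m → ℝ,
          KLRU.IsStationary (KLRU.transition k m (KLRU.zipf n α)) π' → π' = π) ∧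
        ∃ t : ℕ, KLRU.IsMixingTime (KLRU.transition k m (KLRU.zipf n α)) π (1 / 2) t ∧
          (t : ℝ) ≤ C * ((n : ℝ) ^ (((k : ℝ) + 1) * k * (2 * m - 1) * m
            + 4 * (k * α - 1) * m + 6) * Real.log n) := by
  -- Doeblin's bound is `2 * k * m * (n * m) ^ (k * m)`; the factor `Real.log n` costs `1 / Real.log
  -- 2`, since `n ≥ 2`.
  refine ⟨2 * (k * m : ℕ) * (m : ℝ) ^ (k * m) / Real.log 2, fun n hn => ?_⟩
  have hn2 : (2 : ℝ) ≤ n := by exact_mod_cast (by omega : 2 ≤ n)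
  have hm0 : (0 : ℝ) < m := by exact_mod_cast hm
  obtain ⟨z, hz⟩ := KLRU.exists_le_transition_pow (k := k) hm hn hα₀.le hα₁.le
  obtain ⟨π, h1, h2, t, h3, h4⟩ := KLRU.exists_isStationary_isMixingTime
    (KLRU.isStochastic_transition (KLRU.zipf_nonneg n α) (KLRU.sum_zipf (by omega) α))
    (by positivity) hz
  refine ⟨π, h1, h2, t, h3, h4.trans ?_⟩
  have hlog2 : 0 < Real.log 2 := Real.log_pos one_lt_two
  have hlog : Real.log 2 ≤ Real.log n := Real.log_le_log two_pos hn2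
  have hpow : (n : ℝ) ^ (k * m) ≤ (n : ℝ) ^ (((k : ℝ) + 1) * k * (2 * m - 1) * m
      + 4 * (k * α - 1) * m + 6) := by
    rw [← Real.rpow_natCast]
    refine Real.rpow_le_rpow_of_exponent_le (by linarith) ?_
    push_cast
    exact KLRU.mul_le_mixing_exponent (by exact_mod_cast hk) (by exact_mod_cast hm) hα₀.le
  calc 2 * ((k * m : ℕ) : ℝ) / (1 / ((n : ℝ) * m)) ^ (k * m)
      = 2 * (k * m : ℕ) * (m : ℝ) ^ (k * m) / Real.log 2 * ((n : ℝ) ^ (k * m) * Real.log 2) := by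
        rw [one_div, inv_pow, div_inv_eq_mul, mul_pow]
        field_simp
    _ ≤ _ := by
        refine mul_le_mul_of_nonneg_left ?_ (by positivity)
        exact mul_le_mul hpow hlog hlog2.le (by positivity)
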